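/- Let $n$ be an even positive integer. Equip $\mathbb{Z}_2^{2n}$ with the symplectic product $\langle a,b\rangle = a_1\cdot b_2 + a_2\cdot b_1$, where $a=(a_1,a_2)$, $b=(b_1,b_2)$ with $a_i,b_i\in\mathbb{Z}_2^n$; a subspace $M$ is isotropic if $\langle x,y\rangle=0$ for all $x,y\in M$. Let $\mathcal{L}^n_k$ be the set of $k$-dimensional isotropic subspaces of $\mathbb{Z}_2^{2n}$, and for $x,y\in\mathcal{L}^n_n$ put $d(x,y)=n-\dim(x\cap y)$. For $m\in\mathbb{N}$ and $i\ge 1$, let $C^i_m(2)$ be the dual polar graph with vertex set $\mathcal{L}^m_m$ in which $x\sim y$ if and only if $d(x,y)=i$. For $w\in\mathcal{L}^n_1$, let $G_w$ be the graph whose vertices are the $x\in\mathcal{L}^n_n$ with $w\subseteq x$, in which $x\sim y$ if and only if $d(x,y)=\frac n2$. For a finite graph $G$, let $\mathrm{Spec}(G)$ be the set of eigenvalues of its adjacency matrix, let $\lambda(G)$ be the second largest element of the set $\{|l| : l\in\mathrm{Spec}(G)\}$, and call $R(G)=\lambda(G)/\max\mathrm{Spec}(G)$ the spectral ratio of $G$.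 Then for every $w\in\mathcal{L}^n_1$: 1. the vertices of $G_w$ are exactly the maximal isotropic subspaces of $\mathbb{Z}_2^{2n}$ that contain $w$, and two of them are adjacent if and only if their intersection has dimension $\frac n2$; 2. $G_w$ is isomorphic to $C^{n/2}_{n-1}(2)$; 3. $R(G_w)=2^{-n/2}$, i.e. $\log_2 R(G_w)=-\frac12 n$. -/

import Mathlib

/-- The space `ℤ₂²ⁿ`, split into its first `n` and its last `n` coordinates. -/
abbrev PauliSpace (n : ℕ) : Type := (Fin n → ZMod 2) × (Fin n → ZMod 2)

/-- The symplectic product on `ℤ₂²ⁿ`: it vanishes iff `a.1 ⬝ᵥ b.2 = a.2 ⬝ᵥ b.1`. -/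
def sympProd {n : ℕ} (a b : PauliSpace n) : ZMod 2 :=
  dotProduct a.1 b.2 + dotProduct a.2 b.1

/-- Isotropic subspaces of `ℤ₂²ⁿ`. -/
def IsIsotropic {n : ℕ} (M : Submodule (ZMod 2) (PauliSpace n)) : Prop :=
  ∀ x ∈ M, ∀ y ∈ M, sympProd x y = 0

/-- `𝓛ⁿₖ`: the `k`-dimensional isotropic subspaces of `ℤ₂²ⁿ`. -/
def PauliLevel (n k : ℕ) : Type :=
  {x : Submodule (ZMod 2) (PauliSpace n) // IsIsotropic x ∧ Module.finrank (ZMod 2) x = k}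

/-- `𝓛ⁿₙ ∩ ↑w`: the `n`-dimensional isotropic subspaces of `ℤ₂²ⁿ` containing `w`. -/
def PauliAbove {n : ℕ} (w : PauliLevel n 1) : Type :=
  {x : PauliLevel n n // w.1 ≤ x.1}

noncomputable instance (n k : ℕ) : Fintype (PauliLevel n k) :=
  @Fintype.ofFinite _ (inferInstanceAs (Finite {x : Submodule (ZMod 2) (PauliSpace n) //
    IsIsotropic x ∧ Module.finrank (ZMod 2) x = k}))

noncomputable instance {n : ℕ} (w : PauliLevel n 1) : Fintype (PauliAbove w) :=
  @Fintype.ofFinite _ (inferInstanceAs (Finite {x : PauliLevel n n // w.1 ≤ x.1}))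

/-- The distance `d(x, y) = n - dim (x ∩ y)` on `𝓛ⁿₙ` (the subtraction never truncates). -/
noncomputable def pauliDist {n : ℕ} (x y : PauliLevel n n) : ℕ :=
  n - Module.finrank (ZMod 2) ↥(x.1 ⊓ y.1)

theorem pauliDist_comm {n : ℕ} (x y : PauliLevel n n) : pauliDist x y = pauliDist y x :=
  congrArg (fun M : Submodule (ZMod 2) (PauliSpace n) => n - Module.finrank (ZMod 2) M)
    (inf_comm x.1 y.1)

/-- The dual polar graph `Cⁱₙ(2)`, for `i ≥ 1`: vertex set `𝓛ⁿₙ`, and `x ∼ y` iff `d(x, y) = i`.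
The clause `x ≠ y` is automatic for `i ≥ 1`. -/
def dualPolarGraph (i n : ℕ) : SimpleGraph (PauliLevel n n) where
  Adj x y := x ≠ y ∧ pauliDist x y = i
  symm := ⟨fun _ _ h => ⟨h.1.symm, (pauliDist_comm _ _).trans h.2⟩⟩
  loopless := ⟨fun _ h => h.1 rfl⟩

/-- The graph `G_w`: the vertices are the elements of `𝓛ⁿₙ` containing `w`, and
`x ∼ y` iff `d(x, y) = n / 2`. It is used for even `n`; as `w` exists, `n ≥ 1`, so that
`n / 2 ≥ 1` and the clause `x ≠ y` is automatic. -/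
def halfGraph {n : ℕ} (w : PauliLevel n 1) : SimpleGraph (PauliAbove w) where
  Adj x y := x ≠ y ∧ pauliDist x.1 y.1 = n / 2
  symm := ⟨fun _ _ h => ⟨h.1.symm, (pauliDist_comm _ _).trans h.2⟩⟩
  loopless := ⟨fun _ h => h.1 rfl⟩

open Classical in
/-- The spectrum of a finite graph: the set of eigenvalues of its (real symmetric) adjacency
matrix. -/
def graphSpec {V : Type*} [Fintype V] (G : SimpleGraph V) : Set ℝ :=
  {μ | Module.End.HasEigenvalue (Matrix.toLin' (G.adjMatrix ℝ)) μ}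

/-- The set `{|l| : l ∈ Spec G}`. -/
def graphAbsSpec {V : Type*} [Fintype V] (G : SimpleGraph V) : Set ℝ :=
  (fun l : ℝ => |l|) '' graphSpec G

/-- The spectral parameter: the second largest element of the finite set `{|l| : l ∈ Spec G}`. -/
noncomputable def spectralParameter {V : Type*} [Fintype V] (G : SimpleGraph V) : ℝ :=
  sSup (graphAbsSpec G \ {sSup (graphAbsSpec G)})

/-- The spectral ratio: the spectral parameter divided by the largest eigenvalue. -/
noncomputable def spectralRatio {V : Type*} [Fintype V] (G : SimpleGraph V) : ℝ :=
  spectralParameter G / sSup (graphSpec G)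

/-! The space `w^⊥ / w` is symplectic of dimension `2(n - 1)`. Lagrangians through `w` correspond to
its Lagrangians, and the dimension of an intersection drops by one together with the rank, so `d` is
preserved (`nonempty_halfGraph_iso`). The quotient is replaced by an isometric copy `φ` of
`ℤ₂^(2(n-1))` that complements `w` in `w^⊥`.

Let `A_i` be the distance-`i` operator on Lagrangians of rank `m`. Counting vectors gives the
intersection numbers (`sum_neighbors`), hence a three-term recurrence that makes `A_i` a polynomial
in `A_1`. The coefficients of `∏_{l<j} (1 - 2^l X) * ∏_{l<m-j} (1 + 2^(l+1) X)` satisfy the same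
recurrence and vanish beyond degree `m`, just as `A_{m+1} = 0`. So every eigenvalue of `A_i` is the
`i`-th coefficient for some `j ≤ m`.

Let `b` be the `i`-th elementary symmetric function of `1, 2, ..., 2^(m-1)`. For `j = 0` the
eigenvalue is `2^i b`; for `j ≥ 1` its absolute value is at most `b`, with equality at `j = m`. The
ratio is therefore `2^(-i)`, applied with `m = n - 1`, `i = n / 2`. -/

section Symplectic

open Module Submodule

/-! ### The symplectic form -/

/-- The symplectic product as a bilinear form. -/
def sympForm (n : ℕ) : LinearMap.BilinForm (ZMod 2) (PauliSpace n) :=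
  LinearMap.mk₂ (ZMod 2) sympProd
    (fun a b c => by simp only [sympProd, Prod.fst_add, Prod.snd_add, add_dotProduct]; ring)
    (fun r a b => by
      simp only [sympProd, Prod.smul_fst, Prod.smul_snd, smul_dotProduct, smul_eq_mul]; ring)
    (fun a b c => by simp only [sympProd, Prod.fst_add, Prod.snd_add, dotProduct_add]; ring)
    (fun r a b => by
      simp only [sympProd, Prod.smul_fst, Prod.smul_snd, dotProduct_smul, smul_eq_mul]; ring)

theorem sympForm_apply {n : ℕ} (a b : PauliSpace n) : sympForm n a b = sympProd a b := rfl

theorem sympProd_comm {n : ℕ} (a b : PauliSpace n) : sympProd a b = sympProd b a := by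
  simp only [sympProd, dotProduct_comm b.1, dotProduct_comm b.2]; ring

theorem sympProd_self {n : ℕ} (a : PauliSpace n) : sympProd a a = 0 := by
  simp only [sympProd, dotProduct_comm a.2]; exact CharTwo.add_self_eq_zero _

theorem sympProd_add_left {n : ℕ} (a b c : PauliSpace n) :
    sympProd (a + b) c = sympProd a c + sympProd b c := LinearMap.map_add₂ (sympForm n) a b c

theorem sympProd_add_right {n : ℕ} (a b c : PauliSpace n) :
    sympProd a (b + c) = sympProd a b + sympProd a c := map_add (sympForm n a) b c

theorem sympForm_isRefl (n : ℕ) : (sympForm n).IsRefl := fun a b h => by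
  rw [sympForm_apply] at *; rwa [sympProd_comm]

theorem sympForm_nondegenerate (n : ℕ) : (sympForm n).Nondegenerate := by
  rw [LinearMap.BilinForm.Nondegenerate,
    LinearMap.IsRefl.nondegenerate_iff_separatingLeft (sympForm_isRefl n)]
  intro a h
  ext i
  · simpa [sympForm_apply, sympProd] using h (0, Pi.single i 1)
  · simpa [sympForm_apply, sympProd] using h (Pi.single i 1, 0)

theorem finrank_pauliSpace (n : ℕ) : finrank (ZMod 2) (PauliSpace n) = 2 * n := by
  simp [Module.finrank_prod]; ring

/-- The orthogonal complement for the symplectic product. -/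
def sympPerp {n : ℕ} (M : Submodule (ZMod 2) (PauliSpace n)) :
    Submodule (ZMod 2) (PauliSpace n) := (sympForm n).orthogonal M

variable {n : ℕ} {M N x y z : Submodule (ZMod 2) (PauliSpace n)} {u v : PauliSpace n}

theorem mem_sympPerp : v ∈ sympPerp M ↔ ∀ u ∈ M, sympProd u v = 0 := Iff.rfl

theorem mem_sympPerp_span : u ∈ sympPerp (span (ZMod 2) {v}) ↔ sympProd v u = 0 := by
  refine ⟨fun h => h v (mem_span_singleton_self v), fun h => mem_sympPerp.2 fun a ha => ?_⟩
  obtain ⟨r, rfl⟩ := mem_span_singleton.1 ha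
  rw [← sympForm_apply, LinearMap.map_smul₂, sympForm_apply, h, smul_zero]

theorem finrank_sympPerp_add (M : Submodule (ZMod 2) (PauliSpace n)) :
    finrank (ZMod 2) (sympPerp M) + finrank (ZMod 2) M = 2 * n := by
  have h := LinearMap.BilinForm.finrank_orthogonal (sympForm_nondegenerate n) M
  have h2 := Submodule.finrank_le M
  rw [finrank_pauliSpace] at h h2
  unfold sympPerp
  lia

theorem sympPerp_anti (h : M ≤ N) : sympPerp N ≤ sympPerp M :=
  LinearMap.BilinForm.orthogonal_le h

theorem sympPerp_sympPerp (M : Submodule (ZMod 2) (PauliSpace n)) : sympPerp (sympPerp M) = M :=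
  LinearMap.BilinForm.orthogonal_orthogonal (sympForm_nondegenerate n) (sympForm_isRefl n) M

theorem isIsotropic_iff_le_sympPerp : IsIsotropic M ↔ M ≤ sympPerp M :=
  ⟨fun h v hv u hu => h u hu v hv, fun h u hu _ hv => h hv u hu⟩

theorem sympPerp_eq_self (h : IsIsotropic M) (hd : finrank (ZMod 2) M = n) : sympPerp M = M := by
  refine (eq_of_le_of_finrank_le (isIsotropic_iff_le_sympPerp.1 h) ?_).symm
  have := finrank_sympPerp_add M
  lia

theorem IsIsotropic.mono (h : IsIsotropic N) (hM : M ≤ N) : IsIsotropic M :=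
  fun u hu v hv => h u (hM hu) v (hM hv)

theorem isIsotropic_span_singleton (v : PauliSpace n) : IsIsotropic (span (ZMod 2) {v}) := by
  rw [isIsotropic_iff_le_sympPerp, span_singleton_le_iff_mem, mem_sympPerp_span]
  exact sympProd_self v

theorem IsIsotropic.sup (hM : IsIsotropic M) (hN : IsIsotropic N) (h : N ≤ sympPerp M) :
    IsIsotropic (M ⊔ N) := by
  intro a ha b hb
  obtain ⟨a₁, h₁, a₂, h₂, rfl⟩ := mem_sup.1 ha
  obtain ⟨b₁, h₃, b₂, h₄, rfl⟩ := mem_sup.1 hb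
  rw [sympProd_add_left, sympProd_add_right, sympProd_add_right, hM _ h₁ _ h₃, hN _ h₂ _ h₄,
    mem_sympPerp.1 (h h₄) _ h₁, sympProd_comm a₂, mem_sympPerp.1 (h h₂) _ h₃]
  simp

/-- Adjoining a vector of `M^⊥` keeps `M` isotropic, as the form is alternating; so maximality means
`M = M^⊥`, that is, half the total dimension. -/
theorem maximal_isIsotropic_iff :
    Maximal IsIsotropic M ↔ IsIsotropic M ∧ finrank (ZMod 2) M = n := by
  constructor
  · intro h
    have hM := isIsotropic_iff_le_sympPerp.1 h.1
    have key : sympPerp M ≤ M := fun v hv => by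
      have hs : IsIsotropic (M ⊔ span (ZMod 2) {v}) := h.1.sup (isIsotropic_span_singleton v)
        ((span_singleton_le_iff_mem _ _).2 hv)
      exact h.2 hs le_sup_left ((le_sup_right : _ ≤ M ⊔ span (ZMod 2) {v})
        (mem_span_singleton_self v))
    have := finrank_sympPerp_add M
    rw [le_antisymm key hM] at this
    exact ⟨h.1, by lia⟩
  · rintro ⟨h, hd⟩
    refine ⟨h, fun N hN hMN => ?_⟩
    have := (isIsotropic_iff_le_sympPerp.1 hN).trans (sympPerp_anti hMN)
    rwa [sympPerp_eq_self h hd] at this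

theorem finrank_le_finrank_inf_sympPerp_span (x : Submodule (ZMod 2) (PauliSpace n))
    (v : PauliSpace n) :
    finrank (ZMod 2) x ≤ finrank (ZMod 2) ↥(x ⊓ sympPerp (span (ZMod 2) {v})) + 1 := by
  have h₁ := finrank_sympPerp_add (span (ZMod 2) {v})
  have h₂ : finrank (ZMod 2) (span (ZMod 2) {v}) ≤ 1 := by
    simpa using finrank_span_le_card (R := ZMod 2) ({v} : Set (PauliSpace n))
  have h₃ := Submodule.finrank_sup_add_finrank_inf_eq x (sympPerp (span (ZMod 2) {v}))
  have h₄ := Submodule.finrank_le (x ⊔ sympPerp (span (ZMod 2) {v}))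
  rw [finrank_pauliSpace] at h₄
  lia

theorem natCard_submodule (M : Submodule (ZMod 2) (PauliSpace n)) :
    Nat.card M = 2 ^ finrank (ZMod 2) M := by
  rw [Module.natCard_eq_pow_finrank (K := ZMod 2)]; simp

end Symplectic

section Counting

open Module Submodule

/-! ### Intersection numbers of the dual polar graph -/

theorem finrank_le_of_isIsotropic {n : ℕ} {M : Submodule (ZMod 2) (PauliSpace n)}
    (h : IsIsotropic M) : finrank (ZMod 2) M ≤ n := by
  have h₁ := finrank_sympPerp_add M
  have h₂ := Submodule.finrank_mono (isIsotropic_iff_le_sympPerp.1 h)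
  lia

theorem ncard_sdiff {n : ℕ} (M N : Submodule (ZMod 2) (PauliSpace n)) :
    ((M : Set (PauliSpace n)) \ N).ncard + 2 ^ finrank (ZMod 2) ↥(M ⊓ N) =
      2 ^ finrank (ZMod 2) M := by
  rw [← natCard_submodule, ← natCard_submodule,
    show Nat.card ↥(M ⊓ N) = ((M : Set (PauliSpace n)) ∩ N).ncard from rfl,
    show Nat.card M = (M : Set (PauliSpace n)).ncard from rfl, add_comm]
  exact Set.ncard_inter_add_ncard_sdiff_eq_ncard _ _ (Set.toFinite _)

variable {m : ℕ} {x y z : PauliLevel m m}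

theorem PauliLevel.ext {n k : ℕ} {x y : PauliLevel n k} (h : x.1 = y.1) : x = y := Subtype.ext h

theorem finrank_inf_le (x y : PauliLevel m m) : finrank (ZMod 2) ↥(x.1 ⊓ y.1) ≤ m :=
  finrank_le_of_isIsotropic (x.2.1.mono inf_le_left)

theorem pauliDist_add (x y : PauliLevel m m) :
    pauliDist x y + finrank (ZMod 2) ↥(x.1 ⊓ y.1) = m := by
  have := finrank_inf_le x y
  unfold pauliDist
  lia

theorem PauliLevel.sympPerp_eq (x : PauliLevel m m) : sympPerp x.1 = x.1 :=
  sympPerp_eq_self x.2.1 x.2.2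

theorem PauliLevel.eq_of_le (h : x.1 ≤ y.1) : x = y :=
  PauliLevel.ext (eq_of_le_of_finrank_eq h (x.2.2.trans y.2.2.symm))

theorem pauliDist_eq_zero : pauliDist x y = 0 ↔ x = y := by
  constructor
  · intro h
    have h₁ := pauliDist_add x y
    have h₂ : x.1 ⊓ y.1 = x.1 := eq_of_le_of_finrank_eq inf_le_left (by rw [x.2.2]; lia)
    exact PauliLevel.eq_of_le (inf_eq_left.1 h₂)
  · rintro rfl
    have h₁ := pauliDist_add x x
    rw [inf_idem, x.2.2] at h₁
    lia

/-- The neighbour `(x ∩ v^⊥) + ⟨v⟩` of `x` through `v`. -/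
def nbrThrough (x : PauliLevel m m) (v : PauliSpace m) : Submodule (ZMod 2) (PauliSpace m) :=
  (x.1 ⊓ sympPerp (span (ZMod 2) {v})) ⊔ span (ZMod 2) {v}

theorem mem_nbrThrough (x : PauliLevel m m) (v : PauliSpace m) : v ∈ nbrThrough x v :=
  (le_sup_right : _ ≤ nbrThrough x v) (mem_span_singleton_self v)

theorem isIsotropic_nbrThrough (x : PauliLevel m m) (v : PauliSpace m) :
    IsIsotropic (nbrThrough x v) := by
  refine (x.2.1.mono inf_le_left).sup (isIsotropic_span_singleton v) ?_
  exact (sympPerp_sympPerp (span (ZMod 2) {v})).ge.trans (sympPerp_anti inf_le_right)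

theorem finrank_nbrThrough {v : PauliSpace m} (hv : v ∉ x.1) :
    finrank (ZMod 2) (nbrThrough x v) = m := by
  refine le_antisymm (finrank_le_of_isIsotropic (isIsotropic_nbrThrough x v)) ?_
  have h₁ := finrank_le_finrank_inf_sympPerp_span x.1 v
  have h₂ : x.1 ⊓ sympPerp (span (ZMod 2) {v}) < nbrThrough x v := by
    refine lt_of_le_of_ne le_sup_left fun h => hv ?_
    have := mem_nbrThrough x v
    rw [← h] at this
    exact this.1
  have h₃ := finrank_lt_finrank_of_lt h₂
  rw [x.2.2] at h₁
  lia

theorem finrank_inf_nbrThrough {v : PauliSpace m} (hv : v ∉ x.1) :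
    finrank (ZMod 2) ↥(x.1 ⊓ nbrThrough x v) + 1 = m := by
  have h₁ := finrank_le_finrank_inf_sympPerp_span x.1 v
  have h₂ : finrank (ZMod 2) ↥(x.1 ⊓ sympPerp (span (ZMod 2) {v})) ≤
      finrank (ZMod 2) ↥(x.1 ⊓ nbrThrough x v) :=
    Submodule.finrank_mono (le_inf inf_le_left le_sup_left)
  have h₃ : x.1 ⊓ nbrThrough x v < nbrThrough x v :=
    lt_of_le_of_ne inf_le_right fun h => hv (inf_eq_right.1 h (mem_nbrThrough x v))
  have h₄ := finrank_lt_finrank_of_lt h₃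
  rw [finrank_nbrThrough hv] at h₄
  rw [x.2.2] at h₁
  lia

theorem finrank_inf_of_pauliDist_eq_one (h : pauliDist x z = 1) :
    finrank (ZMod 2) ↥(x.1 ⊓ z.1) + 1 = m := by
  have := pauliDist_add x z
  lia

/-- Both `x ∩ z` and `x ∩ v^⊥` are hyperplanes of `x`, the latter being proper because `v ∉ x =
x^⊥`. Thus each vector outside `x` lies in exactly one neighbour of `x`. -/
theorem nbrThrough_eq (h : pauliDist x z = 1) {v : PauliSpace m} (hz : v ∈ z.1) (hx : v ∉ x.1) :
    nbrThrough x v = z.1 := by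
  have h₀ := finrank_inf_of_pauliDist_eq_one h
  have h₁ : x.1 ⊓ z.1 ≤ x.1 ⊓ sympPerp (span (ZMod 2) {v}) :=
    le_inf inf_le_left fun u hu => mem_sympPerp_span.2 (z.2.1 v hz u hu.2)
  have h₂ : x.1 ⊓ sympPerp (span (ZMod 2) {v}) < x.1 := by
    refine lt_of_le_of_ne inf_le_left fun h => hx ?_
    rw [← x.sympPerp_eq]
    intro u hu
    have := mem_sympPerp_span.1 (inf_eq_left.1 h hu)
    rwa [sympProd_comm] at this
  have h₃ := finrank_lt_finrank_of_lt h₂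
  have h₄ : x.1 ⊓ z.1 = x.1 ⊓ sympPerp (span (ZMod 2) {v}) :=
    eq_of_le_of_finrank_le h₁ (by rw [x.2.2] at h₃; lia)
  refine eq_of_le_of_finrank_eq ?_ ((finrank_nbrThrough hx).trans z.2.2.symm)
  refine sup_le (h₄.ge.trans inf_le_right) ((span_singleton_le_iff_mem _ _).2 hz)

/-- Double counting of the vectors of `S` outside `x` by the neighbours of `x` through them. -/
theorem ncard_sdiff_eq_sum (x : PauliLevel m m) (S : Submodule (ZMod 2) (PauliSpace m)) :
    ((S : Set (PauliSpace m)) \ x.1).ncard =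
      ∑ z with pauliDist x z = 1, (((z.1 ⊓ S : Submodule _ _) : Set (PauliSpace m)) \ x.1).ncard := by
  classical
  have hU : (S : Set (PauliSpace m)) \ x.1 =
      ↑((Finset.univ.filter fun z => pauliDist x z = 1).biUnion fun z =>
        ((((z.1 ⊓ S : Submodule _ _) : Set (PauliSpace m)) \ x.1).toFinite.toFinset)) := by
    ext v
    simp only [Set.mem_sdiff, SetLike.mem_coe, Finset.coe_biUnion, Finset.coe_filter,
      Finset.mem_univ, true_and, Set.mem_ofPred_eq, Set.Finite.coe_toFinset, Set.mem_iUnion,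
      exists_prop]
    constructor
    · rintro ⟨hS, hx⟩
      refine ⟨⟨nbrThrough x v, isIsotropic_nbrThrough x v, finrank_nbrThrough hx⟩, ?_,
        ⟨mem_nbrThrough x v, hS⟩, hx⟩
      have := finrank_inf_nbrThrough hx
      unfold pauliDist
      dsimp only
      lia
    · rintro ⟨z, -, hz, hx⟩
      exact ⟨hz.2, hx⟩
  rw [hU, Set.ncard_coe_finset, Finset.card_biUnion]
  · refine Finset.sum_congr rfl fun z _ => ?_
    rw [Set.ncard_eq_toFinset_card _ (Set.toFinite _)]
  · intro z hz z' hz' hne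
    rw [Function.onFun, Finset.disjoint_left]
    intro v hv hv'
    simp only [Set.Finite.mem_toFinset, Set.mem_sdiff, SetLike.mem_coe] at hv hv'
    simp only [Finset.coe_filter, Finset.mem_univ, true_and, Set.mem_ofPred_eq] at hz hz'
    exact hne (PauliLevel.ext ((nbrThrough_eq hz hv.1.1 hv.2).symm.trans
      (nbrThrough_eq hz' hv'.1.1 hv'.2)))

theorem two_mul_ncard_sdiff (h : pauliDist x z = 1) :
    2 * ((z.1 : Set (PauliSpace m)) \ x.1).ncard = 2 ^ m := by
  have h₁ := finrank_inf_of_pauliDist_eq_one h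
  have h₂ := ncard_sdiff z.1 x.1
  rw [inf_comm, z.2.2] at h₂
  have h₃ : 2 ^ (finrank (ZMod 2) ↥(x.1 ⊓ z.1) + 1) = 2 ^ m := by rw [h₁]
  rw [pow_succ] at h₃
  lia

theorem finrank_inf_le_succ (h : pauliDist x z = 1) (y : PauliLevel m m) :
    finrank (ZMod 2) ↥(x.1 ⊓ y.1) ≤ finrank (ZMod 2) ↥(z.1 ⊓ y.1) + 1 := by
  have h₁ := finrank_inf_of_pauliDist_eq_one h
  have h₂ := Submodule.finrank_sup_add_finrank_inf_eq (x.1 ⊓ z.1) (x.1 ⊓ y.1)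
  have h₃ : finrank (ZMod 2) ↥(x.1 ⊓ z.1 ⊔ x.1 ⊓ y.1) ≤ finrank (ZMod 2) x.1 :=
    Submodule.finrank_mono (sup_le inf_le_left inf_le_left)
  have h₄ : finrank (ZMod 2) ↥(x.1 ⊓ z.1 ⊓ (x.1 ⊓ y.1)) ≤ finrank (ZMod 2) ↥(z.1 ⊓ y.1) :=
    Submodule.finrank_mono (inf_le_inf inf_le_right inf_le_right)
  rw [x.2.2] at h₃
  lia

/-- If `v ∈ z ∩ y` is outside `x`, then `z` is the neighbour through `v`, and `x ∩ y ≤ v^⊥` because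
`y` is isotropic. -/
theorem inf_le_of_not_le (h : pauliDist x z = 1) (hzy : ¬ z.1 ⊓ y.1 ≤ x.1) :
    x.1 ⊓ y.1 ≤ z.1 := by
  obtain ⟨v, hv, hx⟩ := SetLike.not_le_iff_exists.1 hzy
  rw [← nbrThrough_eq h hv.1 hx]
  exact le_sup_of_le_left (le_inf inf_le_left fun u hu =>
    mem_sympPerp_span.2 (y.2.1 v hv.2 u hu.2))

theorem finrank_inf_eq_succ_iff (h : pauliDist x z = 1) :
    finrank (ZMod 2) ↥(z.1 ⊓ y.1) = finrank (ZMod 2) ↥(x.1 ⊓ y.1) + 1 ↔ ¬ z.1 ⊓ y.1 ≤ x.1 := by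
  constructor
  · intro he hle
    have := Submodule.finrank_mono (le_inf hle (inf_le_right : z.1 ⊓ y.1 ≤ y.1))
    lia
  · intro hn
    have h₁ := finrank_inf_le_succ (pauliDist_comm x z ▸ h : pauliDist z x = 1) y
    have h₂ : x.1 ⊓ y.1 < z.1 ⊓ y.1 :=
      lt_of_le_of_ne (le_inf (inf_le_of_not_le h hn) inf_le_right)
        fun he => hn (he.ge.trans inf_le_left)
    have h₃ := finrank_lt_finrank_of_lt h₂
    lia

theorem finrank_inf_le_iff (h : pauliDist x z = 1) :
    finrank (ZMod 2) ↥(x.1 ⊓ y.1) ≤ finrank (ZMod 2) ↥(z.1 ⊓ y.1) ↔ x.1 ⊓ y.1 ≤ z.1 := by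
  constructor
  · intro hle
    by_cases hn : z.1 ⊓ y.1 ≤ x.1
    · have := eq_of_le_of_finrank_le (le_inf hn (inf_le_right : z.1 ⊓ y.1 ≤ y.1)) hle
      exact this.ge.trans inf_le_left
    · exact inf_le_of_not_le h hn
  · exact fun hle => Submodule.finrank_mono (le_inf hle inf_le_right)

/-- The closer neighbours are those meeting `y` outside `x`. They partition `y \ x` into pieces of
size `2 ^ dim (x ∩ y)`. -/
theorem card_closer (x y : PauliLevel m m) :
    (Finset.univ.filter fun z => pauliDist x z = 1 ∧ pauliDist z y + 1 = pauliDist x y).card + 1 =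
      2 ^ pauliDist x y := by
  have h := ncard_sdiff_eq_sum x y.1
  have h₁ : ∀ z ∈ Finset.univ.filter fun z => pauliDist x z = 1,
      (((z.1 ⊓ y.1 : Submodule _ _) : Set (PauliSpace m)) \ x.1).ncard =
      if pauliDist z y + 1 = pauliDist x y then 2 ^ finrank (ZMod 2) ↥(x.1 ⊓ y.1) else 0 := by
    intro z hz
    rw [Finset.mem_filter] at hz
    have h₂ := finrank_inf_eq_succ_iff (y := y) hz.2
    have h₃ := pauliDist_add x y
    have h₄ := pauliDist_add z y
    have h₅ := ncard_sdiff (z.1 ⊓ y.1) x.1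
    split_ifs with hc
    · have h₆ := h₂.1 (by lia)
      rw [h₂.2 h₆, inf_right_comm, inf_comm z.1 x.1, inf_assoc, inf_left_comm,
        inf_eq_right.2 (inf_le_of_not_le hz.2 h₆), pow_succ] at h₅
      lia
    · have h₆ : z.1 ⊓ y.1 ≤ x.1 := by
        by_contra hn
        have := h₂.2 hn
        lia
      rwa [Set.ncard_eq_zero, Set.sdiff_eq_empty]
  rw [Finset.sum_congr rfl h₁, ← Finset.sum_filter, Finset.sum_const, Finset.filter_filter,
    smul_eq_mul] at h
  have h₂ := ncard_sdiff y.1 x.1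
  rw [h, y.2.2, inf_comm y.1 x.1] at h₂
  have h₃ : 0 < 2 ^ finrank (ZMod 2) ↥(x.1 ⊓ y.1) := by positivity
  refine Nat.eq_of_mul_eq_mul_right h₃ ?_
  rw [add_mul, one_mul, ← pow_add, pauliDist_add]
  exact h₂

/-- A neighbour `z` is not farther iff `x ∩ y ≤ z`, i.e. `z ≤ (x ∩ y)^⊥`; the other neighbours do
not meet `(x ∩ y)^⊥` outside `x`. Each `z` that counts has half of its vectors outside `x`; doubling
avoids the exponent `m - 1`. -/
theorem card_not_farther (x y : PauliLevel m m) :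
    (Finset.univ.filter fun z => pauliDist x z = 1 ∧ pauliDist z y ≤ pauliDist x y).card + 2 =
      2 ^ (pauliDist x y + 1) := by
  have h := ncard_sdiff_eq_sum x (sympPerp (x.1 ⊓ y.1))
  have h₁ : ∀ z ∈ Finset.univ.filter fun z => pauliDist x z = 1,
      2 * (((z.1 ⊓ sympPerp (x.1 ⊓ y.1) : Submodule _ _) : Set (PauliSpace m)) \ x.1).ncard =
      if pauliDist z y ≤ pauliDist x y then 2 ^ m else 0 := by
    intro z hz
    rw [Finset.mem_filter] at hz
    have h₂ := finrank_inf_le_iff (y := y) hz.2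
    have h₃ := pauliDist_add x y
    have h₄ := pauliDist_add z y
    split_ifs with hc
    · have h₆ := sympPerp_anti (h₂.1 (by lia))
      rw [z.sympPerp_eq] at h₆
      rw [inf_eq_left.2 h₆, two_mul_ncard_sdiff hz.2]
    · rw [mul_eq_zero, Set.ncard_eq_zero, Set.sdiff_eq_empty]
      right
      intro v hv
      by_contra hx
      refine hc ?_
      have h₅ : x.1 ⊓ y.1 ≤ z.1 := by
        rw [← nbrThrough_eq hz.2 hv.1 hx]
        refine le_sup_of_le_left (le_inf inf_le_left fun u hu => mem_sympPerp_span.2 ?_)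
        rw [sympProd_comm]
        exact hv.2 u hu
      have := h₂.2 h₅
      lia
  replace h := congrArg (2 * ·) h
  simp only [Finset.mul_sum] at h
  rw [Finset.sum_congr rfl h₁, ← Finset.sum_filter, Finset.sum_const, Finset.filter_filter,
    smul_eq_mul] at h
  have h₂ := ncard_sdiff (sympPerp (x.1 ⊓ y.1)) x.1
  have h₃ : x.1 ≤ sympPerp (x.1 ⊓ y.1) := x.sympPerp_eq.ge.trans (sympPerp_anti inf_le_left)
  have h₄ := finrank_sympPerp_add (x.1 ⊓ y.1)
  have h₅ := pauliDist_add x y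
  rw [inf_eq_right.2 h₃, x.2.2, show finrank (ZMod 2) (sympPerp (x.1 ⊓ y.1)) =
    pauliDist x y + m by lia, pow_add] at h₂
  have h₆ : 0 < 2 ^ m := by positivity
  refine Nat.eq_of_mul_eq_mul_right h₆ ?_
  rw [pow_succ]
  linarith

theorem card_neighbors (x : PauliLevel m m) :
    (Finset.univ.filter fun z => pauliDist x z = 1).card + 2 = 2 ^ (m + 1) := by
  have h := congrArg (2 * ·) (ncard_sdiff_eq_sum x ⊤)
  simp only [Finset.mul_sum, inf_top_eq] at h
  rw [Finset.sum_congr rfl fun z hz => two_mul_ncard_sdiff (Finset.mem_filter.1 hz).2,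
    Finset.sum_const, smul_eq_mul] at h
  have h₂ := ncard_sdiff ⊤ x.1
  rw [top_inf_eq, x.2.2, finrank_top, finrank_pauliSpace, two_mul, pow_add] at h₂
  have h₆ : 0 < 2 ^ m := by positivity
  refine Nat.eq_of_mul_eq_mul_right h₆ ?_
  rw [pow_succ]
  linarith

/-- The intersection numbers `c_s = a_s = 2 ^ s - 1` and `b_s = 2 ^ (m + 1) - 2 ^ (s + 1)` of the
dual polar graph. -/
theorem sum_neighbors (x y : PauliLevel m m) (g : ℕ → ℝ) :
    ∑ z with pauliDist x z = 1, g (pauliDist z y) =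
      (2 ^ pauliDist x y - 1) * g (pauliDist x y - 1) +
      (2 ^ pauliDist x y - 1) * g (pauliDist x y) +
      (2 ^ (m + 1) - 2 ^ (pauliDist x y + 1)) * g (pauliDist x y + 1) := by
  classical
  have h₁ := congrArg (Nat.cast : ℕ → ℝ) (card_closer x y)
  have h₂ := congrArg (Nat.cast : ℕ → ℝ) (card_not_farther x y)
  have h₃ := congrArg (Nat.cast : ℕ → ℝ) (card_neighbors x)
  set s := pauliDist x y with hs
  -- The distance changes by at most one, so `g` is a combination of the indicators already counted.
  -- For `s = 0` the truncated `s - 1` is harmless: no neighbour is closer.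
  have hsplit : ∀ z ∈ Finset.univ.filter fun z => pauliDist x z = 1, g (pauliDist z y) =
      (if pauliDist z y + 1 = s then 1 else 0) * (g (s - 1) - g s) +
      (if pauliDist z y ≤ s then 1 else 0) * (g s - g (s + 1)) + g (s + 1) := by
    intro z hz
    rw [Finset.mem_filter] at hz
    have e₁ := finrank_inf_le_succ hz.2 y
    have e₂ := finrank_inf_le_succ (pauliDist_comm x z ▸ hz.2 : pauliDist z x = 1) y
    have e₃ := pauliDist_add x y
    have e₄ := pauliDist_add z y
    rcases (by lia : pauliDist z y + 1 = s ∨ pauliDist z y = s ∨ pauliDist z y = s + 1)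
      with h | h | h
    · rw [if_pos h, if_pos (by lia), show pauliDist z y = s - 1 by lia]; ring
    · rw [if_neg (by lia), if_pos (by lia), h]; ring
    · rw [if_neg (by lia), if_neg (by lia), h]; ring
  rw [Finset.sum_congr rfl hsplit, Finset.sum_add_distrib, Finset.sum_add_distrib,
    ← Finset.sum_mul, ← Finset.sum_mul, Finset.sum_boole, Finset.sum_boole, Finset.sum_const,
    Finset.filter_filter, Finset.filter_filter, nsmul_eq_mul]
  push_cast at h₁ h₂ h₃
  rw [← eq_sub_iff_add_eq] at h₁ h₂ h₃
  rw [h₁, h₂, h₃]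
  ring

end Counting

section Coefficients

open Polynomial

/-! ### The eigenvalues of the dual polar graph as elementary symmetric functions -/

/-- The polynomial whose coefficients are the eigenvalues of the distance matrices of the dual polar
graph of rank `j + k` on its `j`-th eigenspace. -/
noncomputable def eigenPoly (j k : ℕ) : ℝ[X] :=
  (∏ l ∈ Finset.range j, (1 - C (2 ^ l) * X)) * ∏ l ∈ Finset.range k, (1 + C (2 ^ (l + 1)) * X)

theorem prod_comp_two_mul_X (k : ℕ) (f : ℕ → ℝ) :
    (∏ l ∈ Finset.range k, (1 + C (f l) * X)).comp (C 2 * X) =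
      ∏ l ∈ Finset.range k, (1 + C (2 * f l) * X) := by
  rw [prod_comp]
  refine Finset.prod_congr rfl fun l _ => ?_
  simp only [add_comp, mul_comp, C_comp, X_comp, one_comp, C_mul]
  ring

theorem eigenPoly_eq (j k : ℕ) : eigenPoly j k =
    (∏ l ∈ Finset.range j, (1 + C (-2 ^ l) * X)) *
      ∏ l ∈ Finset.range k, (1 + C (2 ^ (l + 1)) * X) := by
  simp only [eigenPoly, sub_eq_add_neg, C_neg, neg_mul]

/-- Replacing `X` by `2X` shifts both geometric progressions by one step, so only the end factors
change. -/
theorem eigenPoly_comp (j k : ℕ) :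
    (1 + C 2 * X) * (1 - X) * (eigenPoly j k).comp (C 2 * X) =
      (1 - C (2 ^ j) * X) * (1 + C (2 ^ (k + 1)) * X) * eigenPoly j k := by
  have h₁ : ∀ f : ℕ → ℝ[X], ∀ k, f 0 * ∏ l ∈ Finset.range k, f (l + 1) =
      f k * ∏ l ∈ Finset.range k, f l := fun f k => by
    rw [mul_comm, ← Finset.prod_range_succ', Finset.prod_range_succ, mul_comm]
  have e₁ := h₁ (fun l => 1 + C (-2 ^ l) * X) j
  have e₂ := h₁ (fun l => 1 + C (2 ^ (l + 1)) * X) k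
  rw [eigenPoly_eq, mul_comp, prod_comp_two_mul_X, prod_comp_two_mul_X]
  simp only [mul_neg, ← pow_succ', pow_zero, zero_add, pow_one] at e₁ e₂ ⊢
  simp only [C_neg, C_1] at e₁
  simp only [C_neg]
  linear_combination (1 + C 2 * X) * (∏ l ∈ Finset.range k, (1 + C (2 ^ (l + 1 + 1)) * X)) * e₁ +
    (1 - C (2 ^ j) * X) * (∏ l ∈ Finset.range j, (1 + -C (2 ^ l) * X)) * e₂

theorem eigenPoly_coeff_zero (j k : ℕ) : (eigenPoly j k).coeff 0 = 1 := by
  simp [eigenPoly, coeff_zero_eq_eval_zero, eval_mul, eval_prod]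

theorem eigenPoly_coeff_one (j k : ℕ) :
    (eigenPoly j k).coeff 1 = 2 ^ (k + 1) - 2 ^ j - 1 := by
  have h := congrArg (fun p => p.coeff 1) (eigenPoly_comp j k)
  simp only [show (1 + C 2 * X) * (1 - X) * (eigenPoly j k).comp (C 2 * X) =
      (eigenPoly j k).comp (C 2 * X) + (eigenPoly j k).comp (C 2 * X) * X -
        C 2 * ((eigenPoly j k).comp (C 2 * X) * X ^ 2) by simp only [C_ofNat]; ring,
    show (1 - C (2 ^ j) * X) * (1 + C (2 ^ (k + 1)) * X) * eigenPoly j k = eigenPoly j k +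
      C (2 ^ (k + 1) - 2 ^ j) * (eigenPoly j k * X) - C (2 ^ j * 2 ^ (k + 1)) *
        (eigenPoly j k * X ^ 2) by simp only [C_sub, C_mul]; ring] at h
  have h₁ : ∀ p : ℝ[X], (p * X).coeff 1 = p.coeff 0 := fun p => coeff_mul_X p 0
  have h₂ : ∀ p : ℝ[X], (p * X ^ 2).coeff 1 = 0 := fun p => by simp [coeff_mul_X_pow']
  simp only [coeff_add, coeff_sub, coeff_C_mul, h₁, h₂, comp_C_mul_X_coeff,
    eigenPoly_coeff_zero] at h
  linarith

/-- Comparing coefficients in `eigenPoly_comp` gives the scalar form of `distOp_one_mul` for `m = j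
+ k`. -/
theorem eigenPoly_coeff_rec (j k i : ℕ) :
    (2 ^ (i + 2) - 1) * (eigenPoly j k).coeff (i + 2) =
      ((eigenPoly j k).coeff 1 - (2 ^ (i + 1) - 1)) * (eigenPoly j k).coeff (i + 1) -
        (2 ^ (j + k + 1) - 2 ^ (i + 1)) * (eigenPoly j k).coeff i := by
  have h := congrArg (fun p => p.coeff (i + 2)) (eigenPoly_comp j k)
  simp only [show (1 + C 2 * X) * (1 - X) * (eigenPoly j k).comp (C 2 * X) =
      (eigenPoly j k).comp (C 2 * X) + (eigenPoly j k).comp (C 2 * X) * X -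
        C 2 * ((eigenPoly j k).comp (C 2 * X) * X ^ 2) by simp only [C_ofNat]; ring,
    show (1 - C (2 ^ j) * X) * (1 + C (2 ^ (k + 1)) * X) * eigenPoly j k = eigenPoly j k +
      C (2 ^ (k + 1) - 2 ^ j) * (eigenPoly j k * X) - C (2 ^ j * 2 ^ (k + 1)) *
        (eigenPoly j k * X ^ 2) by simp only [C_sub, C_mul]; ring] at h
  simp only [coeff_add, coeff_sub, coeff_C_mul, coeff_mul_X_pow] at h
  rw [show i + 2 = (i + 1) + 1 from rfl, coeff_mul_X, coeff_mul_X] at h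
  simp only [comp_C_mul_X_coeff] at h
  rw [eigenPoly_coeff_one]
  ring_nf at h ⊢
  linarith

theorem eigenPoly_coeff_eq_zero {j k i : ℕ} (h : j + k < i) : (eigenPoly j k).coeff i = 0 := by
  refine coeff_eq_zero_of_natDegree_lt (lt_of_le_of_lt ?_ h)
  rw [eigenPoly_eq]
  have h₁ : ∀ f : ℕ → ℝ, ∀ k, (∏ l ∈ Finset.range k, (1 + C (f l) * X)).natDegree ≤ k := by
    intro f k
    refine (natDegree_prod_le _ _).trans ?_
    calc _ ≤ ∑ l ∈ Finset.range k, 1 := Finset.sum_le_sum fun l _ => by compute_degree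
      _ = k := by simp
  exact natDegree_mul_le.trans (add_le_add (h₁ _ _) (h₁ _ _))

/-- Monotonicity of elementary symmetric functions, in terms of coefficients. -/
theorem abs_coeff_prod_le (s : Finset ℕ) (f g : ℕ → ℝ) (h : ∀ l ∈ s, |f l| ≤ g l) (i : ℕ) :
    |(∏ l ∈ s, (1 + C (f l) * X)).coeff i| ≤ (∏ l ∈ s, (1 + C (g l) * X)).coeff i := by
  classical
  induction s using Finset.induction_on generalizing i with
  | empty => simp only [Finset.prod_empty, coeff_one]; split_ifs <;> simp
  | insert a s ha ih =>
    have ih' := ih fun l hl => h l (Finset.mem_insert_of_mem hl)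
    rw [Finset.prod_insert ha, Finset.prod_insert ha, add_mul, one_mul, add_mul, one_mul,
      mul_assoc, mul_assoc, coeff_add, coeff_add, coeff_C_mul, coeff_C_mul]
    refine (abs_add_le _ _).trans (add_le_add (ih' i) ?_)
    rw [abs_mul]
    refine mul_le_mul (h a (Finset.mem_insert_self a s)) ?_ (abs_nonneg _)
      ((abs_nonneg _).trans (h a (Finset.mem_insert_self a s)))
    cases i with
    | zero => simp
    | succ i => rw [coeff_X_mul, coeff_X_mul]; exact ih' i

/-- `∏_{l < d} (1 + 2 ^ l X)`. -/
noncomputable def gaussPoly (d : ℕ) : ℝ[X] := ∏ l ∈ Finset.range d, (1 + C (2 ^ l) * X)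

theorem eigenPoly_zero_coeff (d i : ℕ) :
    (eigenPoly 0 d).coeff i = 2 ^ i * (gaussPoly d).coeff i := by
  have h := prod_comp_two_mul_X d fun l => 2 ^ l
  simp only [← pow_succ'] at h
  rw [eigenPoly, Finset.prod_range_zero, one_mul, ← h, comp_C_mul_X_coeff, mul_comm, gaussPoly]

theorem eigenPoly_self_coeff (d i : ℕ) :
    (eigenPoly d 0).coeff i = (-1) ^ i * (gaussPoly d).coeff i := by
  have h : eigenPoly d 0 = (gaussPoly d).comp (C (-1) * X) := by
    rw [eigenPoly_eq, Finset.prod_range_zero, mul_one, gaussPoly, prod_comp]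
    refine Finset.prod_congr rfl fun l _ => ?_
    simp
  rw [h, comp_C_mul_X_coeff, mul_comm]

/-- In absolute value the scalars are `1, ..., 2^j` and `2, ..., 2^k`; termwise they are at most `1,
..., 2^(j+k)`. -/
theorem abs_eigenPoly_coeff_le (j k i : ℕ) :
    |(eigenPoly (j + 1) k).coeff i| ≤ (gaussPoly (j + 1 + k)).coeff i := by
  have h := abs_coeff_prod_le (Finset.range (j + 1 + k))
    (fun l => if l < j + 1 then -2 ^ l else 2 ^ (l - (j + 1) + 1)) (fun l => 2 ^ l) (fun l hl => by
      split_ifs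
      · simp
      · rw [abs_of_nonneg (by positivity)]
        exact pow_le_pow_right₀ one_le_two (by lia)) i
  rw [Finset.prod_range_add] at h
  rw [eigenPoly_eq, gaussPoly]
  convert h using 4
  · refine Finset.prod_congr rfl fun l hl => ?_
    rw [if_pos (Finset.mem_range.1 hl)]
  · refine Finset.prod_congr rfl fun l hl => ?_
    rw [if_neg (by lia), Nat.add_sub_cancel_left]

theorem gaussPoly_coeff_pos {d i : ℕ} (h : i ≤ d) : 0 < (gaussPoly d).coeff i := by
  have h₁ : ∀ d i, 0 ≤ (gaussPoly d).coeff i := fun d i =>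
    (abs_nonneg _).trans (abs_coeff_prod_le _ _ _ (fun l _ => (abs_of_nonneg (by positivity)).le) i)
  induction d generalizing i with
  | zero => simp [gaussPoly, Nat.le_zero.1 h]
  | succ d ih =>
    have hs : gaussPoly (d + 1) = gaussPoly d + C (2 ^ d) * (gaussPoly d * X) := by
      rw [gaussPoly, Finset.prod_range_succ, ← gaussPoly]; ring
    rw [hs, coeff_add, coeff_C_mul]
    cases i with
    | zero => simpa using ih (Nat.zero_le _)
    | succ i =>
      rw [coeff_mul_X]
      have := ih (Nat.le_of_succ_le_succ h)
      have := h₁ d (i + 1)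
      positivity

end Coefficients

section Spectrum

open Polynomial

/-! ### The spectrum of the distance matrices -/

variable {m : ℕ}

/-- The operator on functions on `𝓛ᵐₘ` given by the relation `d(x, y) = i`. -/
noncomputable def distOp (m i : ℕ) : Module.End ℝ (PauliLevel m m → ℝ) where
  toFun f x := ∑ z with pauliDist x z = i, f z
  map_add' f g := funext fun x => Finset.sum_add_distrib
  map_smul' r f := funext fun x => by simp [Finset.mul_sum]

theorem distOp_apply (i : ℕ) (f : PauliLevel m m → ℝ) (x : PauliLevel m m) :
    distOp m i f x = ∑ z with pauliDist x z = i, f z := rfl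

theorem distOp_apply_eq (i : ℕ) (f : PauliLevel m m → ℝ) (x : PauliLevel m m) :
    distOp m i f x = ∑ y, (if pauliDist x y = i then 1 else 0) * f y := by
  rw [distOp_apply, Finset.sum_filter]
  exact Finset.sum_congr rfl fun y _ => by simp

theorem distOp_zero : distOp m 0 = 1 := by
  classical
  refine LinearMap.ext fun f => funext fun x => ?_
  rw [distOp_apply, Module.End.one_apply]
  simp only [pauliDist_eq_zero]
  simp [Finset.sum_filter]

theorem distOp_eq_zero {i : ℕ} (h : m < i) : distOp m i = 0 := by
  refine LinearMap.ext fun f => funext fun x => ?_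
  rw [distOp_apply, Finset.filter_false_of_mem]
  · rfl
  · intro z _
    have := pauliDist_add x z
    lia

/-- The three-term recurrence of the distance operators. -/
theorem distOp_one_mul (i : ℕ) : distOp m 1 * distOp m (i + 1) =
    (2 ^ (i + 2) - 1 : ℝ) • distOp m (i + 2) + (2 ^ (i + 1) - 1 : ℝ) • distOp m (i + 1) +
      (2 ^ (m + 1) - 2 ^ (i + 1) : ℝ) • distOp m i := by
  refine LinearMap.ext fun f => funext fun x => ?_
  simp only [Module.End.mul_apply, LinearMap.add_apply, LinearMap.smul_apply, Pi.add_apply,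
    Pi.smul_apply, smul_eq_mul]
  rw [distOp_apply]
  simp only [distOp_apply_eq]
  rw [Finset.sum_comm, Finset.mul_sum, Finset.mul_sum, Finset.mul_sum, ← Finset.sum_add_distrib,
    ← Finset.sum_add_distrib]
  refine Finset.sum_congr rfl fun y _ => ?_
  rw [← Finset.sum_mul, sum_neighbors x y fun s => if s = i + 1 then 1 else 0]
  rcases (by lia : pauliDist x y = i + 2 ∨ pauliDist x y = i + 1 ∨ pauliDist x y = i ∨
    (pauliDist x y ≠ i + 2 ∧ pauliDist x y ≠ i + 1 ∧ pauliDist x y ≠ i)) with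
    h | h | h | ⟨h, h', h''⟩
  · simp [h]
  · simp [h]
  · simp [h]
  · have e : pauliDist x y - 1 ≠ i + 1 := by lia
    simp [h, h', h'', e]

/-- The polynomials expressing the distance operators through the first one. -/
noncomputable def distPoly (m : ℕ) : ℕ → ℝ[X]
  | 0 => 1
  | 1 => X
  | i + 2 => C (2 ^ (i + 2) - 1)⁻¹ * ((X - C (2 ^ (i + 1) - 1)) * distPoly m (i + 1) -
      C (2 ^ (m + 1) - 2 ^ (i + 1)) * distPoly m i)

theorem two_pow_succ_sub_one_ne_zero (i : ℕ) : (2 ^ (i + 1) - 1 : ℝ) ≠ 0 :=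
  (sub_pos.2 (one_lt_pow₀ one_lt_two (Nat.succ_ne_zero i))).ne'

theorem aeval_distPoly (i : ℕ) : aeval (distOp m 1) (distPoly m i) = distOp m i := by
  induction i using Nat.strong_induction_on with
  | _ i ih =>
    match i with
    | 0 => rw [distPoly, map_one, distOp_zero]
    | 1 => rw [distPoly, aeval_X]
    | i + 2 =>
      rw [distPoly, map_mul, map_sub, map_mul, map_mul, map_sub, aeval_X, aeval_C, aeval_C, aeval_C,
        ih i (by lia), ih (i + 1) (by lia), sub_mul, distOp_one_mul]
      simp only [← Algebra.smul_def]
      rw [add_assoc, add_sub_assoc, add_sub_cancel_left, add_sub_cancel_right, smul_smul,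
        inv_mul_cancel₀ (two_pow_succ_sub_one_ne_zero (i + 1)), one_smul]

theorem natDegree_distPoly_le (m i : ℕ) : (distPoly m i).natDegree ≤ i := by
  induction i using Nat.strong_induction_on with
  | _ i ih =>
    match i with
    | 0 => simp [distPoly]
    | 1 => simp [distPoly]
    | i + 2 =>
      rw [distPoly]
      refine (natDegree_C_mul_le _ _).trans ((natDegree_sub_le _ _).trans (max_le ?_ ?_))
      · refine natDegree_mul_le.trans ?_
        have := ih (i + 1) (by lia)
        have := natDegree_X_sub_C (2 ^ (i + 1) - 1 : ℝ)
        lia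
      · exact (natDegree_C_mul_le _ _).trans ((ih i (by lia)).trans (by lia))

theorem distPoly_coeff_self_ne_zero (m i : ℕ) : (distPoly m i).coeff i ≠ 0 := by
  induction i using Nat.strong_induction_on with
  | _ i ih =>
    match i with
    | 0 => simp [distPoly]
    | 1 => simp [distPoly]
    | i + 2 =>
      have h₁ : (distPoly m (i + 1)).coeff (i + 2) = 0 :=
        coeff_eq_zero_of_natDegree_lt (lt_of_le_of_lt (natDegree_distPoly_le m _) (by lia))
      have h₂ : (distPoly m i).coeff (i + 2) = 0 :=
        coeff_eq_zero_of_natDegree_lt (lt_of_le_of_lt (natDegree_distPoly_le m _) (by lia))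
      rw [distPoly, coeff_C_mul, coeff_sub, sub_mul, coeff_sub, coeff_C_mul, coeff_C_mul, h₁, h₂,
        coeff_X_mul, mul_zero, mul_zero, sub_zero, sub_zero]
      exact mul_ne_zero (inv_ne_zero (two_pow_succ_sub_one_ne_zero (i + 1))) (ih _ (by lia))

theorem eval_distPoly {j : ℕ} (hj : j ≤ m) (i : ℕ) :
    (distPoly m i).eval ((eigenPoly j (m - j)).coeff 1) = (eigenPoly j (m - j)).coeff i := by
  induction i using Nat.strong_induction_on with
  | _ i ih =>
    match i with
    | 0 => rw [distPoly, eval_one, eigenPoly_coeff_zero]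
    | 1 => rw [distPoly, eval_X]
    | i + 2 =>
      rw [distPoly, eval_mul, eval_sub, eval_mul, eval_mul, eval_sub, eval_X, eval_C, eval_C, eval_C,
        ih i (by lia), ih (i + 1) (by lia), inv_mul_eq_iff_eq_mul₀
          (two_pow_succ_sub_one_ne_zero (i + 1)), eigenPoly_coeff_rec, show j + (m - j) = m by lia]

/-- The eigenvalues of `distOp m 1`. -/
noncomputable def distEigenvalues (m : ℕ) : Finset ℝ :=
  (Finset.range (m + 1)).image fun j => (eigenPoly j (m - j)).coeff 1

theorem card_distEigenvalues (m : ℕ) : (distEigenvalues m).card = m + 1 := by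
  rw [distEigenvalues, Finset.card_image_of_injOn, Finset.card_range]
  have key : ∀ j k, j < k → k ≤ m →
      (eigenPoly k (m - k)).coeff 1 < (eigenPoly j (m - j)).coeff 1 := by
    intro j k hjk hk
    rw [eigenPoly_coeff_one, eigenPoly_coeff_one]
    have h₁ : (2 : ℝ) ^ j < 2 ^ k := pow_lt_pow_right₀ one_lt_two hjk
    have h₂ : (2 : ℝ) ^ (m - k + 1) < 2 ^ (m - j + 1) := pow_lt_pow_right₀ one_lt_two (by lia)
    linarith
  intro j hj k hk h
  simp only [Finset.coe_range, Set.mem_Iio] at hj hk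
  rcases lt_trichotomy j k with h' | h' | h'
  · exact absurd h (key j k h' (by lia)).ne'
  · exact h'
  · exact absurd h (key k j h' (by lia)).ne

/-- The nonzero polynomial `distPoly m (m + 1)` has degree at most `m + 1` and `m + 1` distinct
known roots, so it is a scalar multiple of the product; at `A_1` it takes the value `A_{m+1} = 0`.
-/
theorem aeval_prod_distEigenvalues (m : ℕ) :
    aeval (distOp m 1) (∏ θ ∈ distEigenvalues m, (X - C θ)) = 0 := by
  have h0 : distPoly m (m + 1) ≠ 0 := fun h =>
    distPoly_coeff_self_ne_zero m (m + 1) (by rw [h, coeff_zero])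
  have hdvd : ∏ θ ∈ distEigenvalues m, (X - C θ) ∣ distPoly m (m + 1) := by
    refine Finset.prod_dvd_of_coprime (fun a _ b _ hab => isCoprime_X_sub_C_of_isUnit_sub
      (sub_ne_zero.2 hab).isUnit) fun θ hθ => ?_
    obtain ⟨j, hj, rfl⟩ := Finset.mem_image.1 hθ
    have hj' : j ≤ m := Nat.lt_succ_iff.1 (Finset.mem_range.1 hj)
    rw [dvd_iff_isRoot, IsRoot.def, eval_distPoly hj', eigenPoly_coeff_eq_zero (by lia)]
  obtain ⟨q, hq⟩ := hdvd
  have hq0 : q ≠ 0 := fun h => h0 (by rw [hq, h, mul_zero])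
  have hdeg := natDegree_distPoly_le m (m + 1)
  rw [hq, natDegree_mul (Finset.prod_ne_zero_iff.2 fun θ _ => X_sub_C_ne_zero θ) hq0,
    natDegree_finsetProd_X_sub_C_eq_card, card_distEigenvalues] at hdeg
  obtain ⟨c, rfl⟩ : ∃ c, q = C c := ⟨_, eq_C_of_natDegree_le_zero (by lia)⟩
  have h := aeval_distPoly (m := m) (m + 1)
  rw [hq, map_mul, aeval_C, distOp_eq_zero (Nat.lt_succ_self m), ← Algebra.commutes,
    ← Algebra.smul_def] at h
  exact (smul_eq_zero.1 h).resolve_left fun hc => hq0 (by rw [hc, C_0])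

/-- An eigenvector of `S` killed by a product of factors `T - θ`, with `T` commuting with `S`,
yields a common eigenvector. -/
theorem exists_common_eigenvector {K V : Type*} [Field K] [AddCommGroup V] [Module K V]
    {S T : Module.End K V} (hST : Commute S T) (s : Finset K) {c : K} {v : V} (hv : v ≠ 0)
    (hS : S v = c • v) (h : aeval T (∏ θ ∈ s, (X - C θ)) v = 0) :
    ∃ θ ∈ s, ∃ u, u ≠ 0 ∧ T u = θ • u ∧ S u = c • u := by
  classical
  induction s using Finset.induction_on generalizing v with
  | empty => simp [hv] at h
  | insert a s ha ih =>
    by_cases hw : T v = a • v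
    · exact ⟨a, Finset.mem_insert_self a s, v, hv, hw, hS⟩
    -- `(T - a) v` is still an eigenvector of `S`, and the remaining factors kill it.
    · obtain ⟨θ, hθ, u, hu⟩ := ih (v := T v - a • v) (sub_ne_zero.2 hw) (by
          rw [map_sub, map_smul, hS, smul_sub, ← Module.End.mul_apply, hST.eq,
            Module.End.mul_apply, hS, map_smul, smul_comm a c]) (by
          rw [Finset.prod_insert ha, mul_comm, map_mul, map_sub, aeval_X, aeval_C,
            Module.End.mul_apply] at h
          exact h)
      exact ⟨θ, Finset.mem_insert_of_mem hθ, u, hu⟩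

theorem distOp_apply_eigenvector {j : ℕ} (hj : j ≤ m) {u : PauliLevel m m → ℝ}
    (hu : distOp m 1 u = (eigenPoly j (m - j)).coeff 1 • u) (i : ℕ) :
    distOp m i u = (eigenPoly j (m - j)).coeff i • u := by
  rw [← aeval_distPoly i, ← eval_distPoly hj i]
  by_cases h0 : u = 0
  · simp [h0]
  · exact Module.End.aeval_apply_of_hasEigenvector ⟨Module.End.mem_eigenspace_iff.2 hu, h0⟩

/-- Only this inclusion is needed for general `j`; eigenvectors are exhibited only for `j = 0` and
`j = m`. -/
theorem exists_eq_coeff_of_eigenvector {i : ℕ} {c : ℝ} {v : PauliLevel m m → ℝ} (hv : v ≠ 0)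
    (h : distOp m i v = c • v) : ∃ j ≤ m, c = (eigenPoly j (m - j)).coeff i := by
  have hcomm : Commute (distOp m i) (distOp m 1) := by
    rw [← aeval_distPoly i]
    simpa only [aeval_X] using (Commute.all (distPoly m i) X).map (aeval (distOp m 1))
  obtain ⟨θ, hθ, u, hu, hT, hS⟩ := exists_common_eigenvector hcomm (distEigenvalues m) hv h (by
    rw [aeval_prod_distEigenvalues, LinearMap.zero_apply])
  obtain ⟨j, hj, rfl⟩ := Finset.mem_image.1 hθ
  have hj' : j ≤ m := Nat.lt_succ_iff.1 (Finset.mem_range.1 hj)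
  refine ⟨j, hj', ?_⟩
  rw [distOp_apply_eigenvector hj' hT i] at hS
  exact (smul_left_injective ℝ hu hS).symm

theorem distOp_one_apply_const :
    distOp m 1 (fun _ => 1) = (eigenPoly 0 (m - 0)).coeff 1 • fun _ => (1 : ℝ) := by
  ext x
  have h := sum_neighbors x x fun _ => 1
  rw [distOp_apply, h, Pi.smul_apply, eigenPoly_coeff_one, smul_eq_mul, Nat.sub_zero]
  ring

/-- The ratio `-1/2` is read off at `x = y`, where the `2^(m+1) - 2` neighbours must contribute `1 -
2^m`. -/
theorem distOp_one_apply_pow (y : PauliLevel m m) :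
    distOp m 1 (fun x => (-1 / 2) ^ pauliDist x y) =
      (eigenPoly m (m - m)).coeff 1 • fun x => (-1 / 2 : ℝ) ^ pauliDist x y := by
  ext x
  have h := sum_neighbors x y fun s => (-1 / 2) ^ s
  rw [distOp_apply, h, Pi.smul_apply, eigenPoly_coeff_one, smul_eq_mul, Nat.sub_self]
  cases pauliDist x y with
  | zero => simp; ring
  | succ s => rw [Nat.add_sub_cancel]; ring

instance : Nonempty (PauliLevel m m) := by
  refine ⟨⟨LinearMap.range (LinearMap.inl (ZMod 2) (Fin m → ZMod 2) (Fin m → ZMod 2)), ?_, ?_⟩⟩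
  · rintro _ ⟨a, rfl⟩ _ ⟨b, rfl⟩
    simp [sympProd]
  · rw [LinearMap.finrank_range_of_inj LinearMap.inl_injective, Module.finrank_fin_fun]

/-! ### Graph spectra and the spectral ratio of the dual polar graph -/

theorem mem_graphSpec_iff {V : Type*} [Fintype V] {G : SimpleGraph V} {c : ℝ} :
    c ∈ graphSpec G ↔ ∃ f : V → ℝ, f ≠ 0 ∧
      ∀ x, (∑ y, (open Classical in if G.Adj x y then 1 else 0) * f y) = c * f x := by
  classical
  rw [graphSpec, Set.mem_ofPred_eq]
  constructor
  · intro h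
    obtain ⟨f, hf⟩ := h.exists_hasEigenvector
    refine ⟨f, hf.2, fun x => ?_⟩
    have := congrFun hf.apply_eq_smul x
    rw [Matrix.toLin'_apply] at this
    simp only [Matrix.mulVec, dotProduct, SimpleGraph.adjMatrix_apply, Pi.smul_apply,
      smul_eq_mul] at this
    rw [← this]
  · rintro ⟨f, h0, hf⟩
    refine Module.End.hasEigenvalue_of_hasEigenvector (x := f)
      ⟨Module.End.mem_eigenspace_iff.2 (funext fun x => ?_), h0⟩
    rw [Matrix.toLin'_apply, Pi.smul_apply, smul_eq_mul, ← hf x]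
    simp only [Matrix.mulVec, dotProduct, SimpleGraph.adjMatrix_apply]

theorem mem_graphSpec_dualPolarGraph {i : ℕ} (hi : i ≠ 0) {c : ℝ} :
    c ∈ graphSpec (dualPolarGraph i m) ↔ ∃ f : PauliLevel m m → ℝ, f ≠ 0 ∧
      distOp m i f = c • f := by
  classical
  have hadj : ∀ x y, (dualPolarGraph i m).Adj x y ↔ pauliDist x y = i := fun x y =>
    ⟨fun h => h.2, fun h => ⟨fun e => hi (by rw [← h, pauliDist_eq_zero.2 e]), h⟩⟩
  rw [mem_graphSpec_iff]
  simp only [hadj, funext_iff, distOp_apply_eq, Pi.smul_apply, smul_eq_mul, ne_eq]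

theorem graphSpec_eq_of_iso {V W : Type*} [Fintype V] [Fintype W] {G : SimpleGraph V}
    {H : SimpleGraph W} (e : G ≃g H) : graphSpec G = graphSpec H := by
  classical
  ext c
  rw [mem_graphSpec_iff, mem_graphSpec_iff]
  constructor
  · rintro ⟨f, h0, hf⟩
    refine ⟨f ∘ e.symm, fun h => h0 (funext fun x => ?_), fun x => ?_⟩
    · simpa using congrFun h (e x)
    · rw [Function.comp_apply, ← hf, ← e.toEquiv.sum_comp]
      refine Finset.sum_congr rfl fun y _ => ?_
      have : H.Adj x (e y) ↔ G.Adj (e.symm x) y := by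
        rw [← e.map_adj_iff, e.apply_symm_apply]
      simp [this]
  · rintro ⟨f, h0, hf⟩
    refine ⟨f ∘ e, fun h => h0 (funext fun x => ?_), fun x => ?_⟩
    · simpa using congrFun h (e.symm x)
    · rw [Function.comp_apply, ← hf, ← e.toEquiv.sum_comp]
      refine Finset.sum_congr rfl fun y _ => ?_
      have : H.Adj (e x) (e y) ↔ G.Adj x y := e.map_adj_iff
      simp [this]

theorem spectralRatio_eq_of_iso {V W : Type*} [Fintype V] [Fintype W] {G : SimpleGraph V}
    {H : SimpleGraph W} (e : G ≃g H) : spectralRatio G = spectralRatio H := by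
  simp only [spectralRatio, spectralParameter, graphAbsSpec, graphSpec_eq_of_iso e]

theorem spectralRatio_dualPolarGraph {i : ℕ} (hi : i ≠ 0) (him : i ≤ m) :
    spectralRatio (dualPolarGraph i m) = (2 ^ i)⁻¹ := by
  set b := (gaussPoly m).coeff i with hb
  have hb0 : 0 < b := gaussPoly_coeff_pos him
  have h2 : (1 : ℝ) < 2 ^ i := one_lt_pow₀ one_lt_two hi
  have hlt : b < 2 ^ i * b := lt_mul_of_one_lt_left hb0 h2
  have hspec : ∀ c ∈ graphSpec (dualPolarGraph i m), c = 2 ^ i * b ∨ |c| ≤ b := by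
    intro c hc
    obtain ⟨f, h0, hf⟩ := (mem_graphSpec_dualPolarGraph hi).1 hc
    obtain ⟨j, hj, rfl⟩ := exists_eq_coeff_of_eigenvector h0 hf
    cases j with
    | zero => left; rw [Nat.sub_zero, eigenPoly_zero_coeff]
    | succ j =>
      right
      have := abs_eigenPoly_coeff_le j (m - (j + 1)) i
      rwa [show j + 1 + (m - (j + 1)) = m by lia] at this
  have hmax : 2 ^ i * b ∈ graphSpec (dualPolarGraph i m) := by
    refine (mem_graphSpec_dualPolarGraph hi).2 ⟨fun _ => 1, fun h => ?_, ?_⟩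
    · exact one_ne_zero (congrFun h (Classical.arbitrary _))
    · rw [distOp_apply_eigenvector (Nat.zero_le m) distOp_one_apply_const, Nat.sub_zero,
        eigenPoly_zero_coeff]
  have hmin : (-1) ^ i * b ∈ graphSpec (dualPolarGraph i m) := by
    let y : PauliLevel m m := Classical.arbitrary _
    refine (mem_graphSpec_dualPolarGraph hi).2 ⟨fun x => (-1 / 2) ^ pauliDist x y, fun h => ?_, ?_⟩
    · have := congrFun h y
      simp [pauliDist_eq_zero.2 (rfl : y = y)] at this
    · rw [distOp_apply_eigenvector le_rfl (distOp_one_apply_pow y), Nat.sub_self,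
        eigenPoly_self_coeff]
  have h₁ : IsGreatest (graphSpec (dualPolarGraph i m)) (2 ^ i * b) := by
    refine ⟨hmax, fun c hc => ?_⟩
    rcases hspec c hc with h | h
    · exact h.le
    · exact (le_abs_self c).trans (h.trans hlt.le)
  have h₂ : IsGreatest (graphAbsSpec (dualPolarGraph i m)) (2 ^ i * b) := by
    refine ⟨⟨_, hmax, abs_of_pos (by positivity)⟩, ?_⟩
    rintro _ ⟨c, hc, rfl⟩
    rcases hspec c hc with h | h
    · simp only [h]; exact (abs_of_pos (by positivity)).le
    · exact h.trans hlt.le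
  have h₃ : IsGreatest (graphAbsSpec (dualPolarGraph i m) \ {2 ^ i * b}) b := by
    refine ⟨⟨⟨_, hmin, ?_⟩, hlt.ne⟩, ?_⟩
    · simp [abs_mul, abs_of_pos hb0]
    · rintro _ ⟨⟨c, hc, rfl⟩, hne⟩
      rcases hspec c hc with h | h
      · exact absurd (by simp only [h]; exact abs_of_pos (by positivity)) hne
      · exact h
  rw [spectralRatio, spectralParameter, h₁.csSup_eq, h₂.csSup_eq, h₃.csSup_eq]
  field_simp

end Spectrum

section Embedding

open Module Submodule

/-! ### The Lagrangians containing a given line -/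

/-- The transvection along `a + b` sends `a` to `a + (a + b) = b`. -/
theorem exists_isometry_map_eq_of_sympProd {n : ℕ} {a b : PauliSpace n} (h : sympProd a b = 1) :
    ∃ g : PauliSpace n →ₗ[ZMod 2] PauliSpace n,
      (∀ u v, sympProd (g u) (g v) = sympProd u v) ∧ g a = b := by
  have hg : ∀ u, (LinearMap.id + (sympForm n (a + b)).smulRight (a + b) :
      PauliSpace n →ₗ[ZMod 2] PauliSpace n) u =
      u + sympProd (a + b) u • (a + b) := fun u => rfl
  refine ⟨LinearMap.id + (sympForm n (a + b)).smulRight (a + b), fun u v => ?_, ?_⟩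
  · have hl : ∀ (r : ZMod 2) (p q : PauliSpace n), sympProd (r • p) q = r * sympProd p q :=
      fun r p q => LinearMap.map_smul₂ (sympForm n) r p q
    have hr : ∀ (r : ZMod 2) (p q : PauliSpace n), sympProd p (r • q) = r * sympProd p q :=
      fun r p q => map_smul (sympForm n p) r q
    rw [hg, hg, sympProd_add_left, sympProd_add_right, sympProd_add_right, hl, hl, hr, hr,
      sympProd_self, sympProd_comm u (a + b)]
    linear_combination CharTwo.add_self_eq_zero (sympProd (a + b) u * sympProd (a + b) v)
  · rw [hg, sympProd_add_left, sympProd_self, sympProd_comm b a, h, zero_add, one_smul, ← add_assoc,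
      ← two_smul (ZMod 2) a, show (2 : ZMod 2) = 0 from rfl, zero_smul, zero_add]

theorem exists_sympProd_eq_one {n : ℕ} {a : PauliSpace n} (ha : a ≠ 0) :
    ∃ c, sympProd a c = 1 := by
  by_contra! h
  refine ha ((sympForm_nondegenerate n).1 a fun c => ?_)
  have h01 : ∀ t : ZMod 2, t ≠ 1 → t = 0 := by decide
  exact h01 _ (h c)

/-- Two transvections suffice, through a vector `c` that pairs to `1` with both `a` and `b`. -/
theorem exists_isometry_map_eq {n : ℕ} {a b : PauliSpace n} (ha : a ≠ 0) (hb : b ≠ 0) :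
    ∃ g : PauliSpace n →ₗ[ZMod 2] PauliSpace n,
      (∀ u v, sympProd (g u) (g v) = sympProd u v) ∧ g a = b := by
  have h01 : ∀ t : ZMod 2, t ≠ 1 → t = 0 := by decide
  obtain ⟨c, hac, hcb⟩ : ∃ c, sympProd a c = 1 ∧ sympProd c b = 1 := by
    obtain ⟨c, hc⟩ := exists_sympProd_eq_one ha
    obtain ⟨d, hd⟩ := exists_sympProd_eq_one hb
    rw [sympProd_comm] at hd
    by_cases h₁ : sympProd c b = 1
    · exact ⟨c, hc, h₁⟩
    by_cases h₂ : sympProd a d = 1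
    · exact ⟨d, h₂, hd⟩
    · refine ⟨c + d, ?_, ?_⟩
      · rw [sympProd_add_right, hc, h01 _ h₂, add_zero]
      · rw [sympProd_add_left, hd, h01 _ h₁, zero_add]
  obtain ⟨g, hg, hga⟩ := exists_isometry_map_eq_of_sympProd hac
  obtain ⟨g', hg', hgc⟩ := exists_isometry_map_eq_of_sympProd hcb
  exact ⟨g' ∘ₗ g, fun u v => by simp only [LinearMap.comp_apply, hg, hg'],
    by rw [LinearMap.comp_apply, hga, hgc]⟩

theorem isometry_injective {m n : ℕ} {g : PauliSpace m →ₗ[ZMod 2] PauliSpace n}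
    (hg : ∀ u v, sympProd (g u) (g v) = sympProd u v) : Function.Injective g := by
  rw [← LinearMap.ker_eq_bot, LinearMap.ker_eq_bot']
  intro u hu
  by_contra h0
  obtain ⟨c, hc⟩ := exists_sympProd_eq_one h0
  rw [← hg, hu, ← sympForm_apply, map_zero, LinearMap.zero_apply] at hc
  exact zero_ne_one hc

/-- Appending a zero coordinate to both halves. -/
def pauliCons (m : ℕ) : PauliSpace m →ₗ[ZMod 2] PauliSpace (m + 1) where
  toFun a := (Matrix.vecCons 0 a.1, Matrix.vecCons 0 a.2)
  map_add' a b := by simp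
  map_smul' r a := by simp

theorem sympProd_pauliCons {m : ℕ} (u v : PauliSpace m) :
    sympProd (pauliCons m u) (pauliCons m v) = sympProd u v := by
  simp [pauliCons, sympProd]

variable {m : ℕ} {w : PauliLevel (m + 1) 1}

/-- An isometric embedding onto a complement of `w` in `w^⊥`. -/
theorem exists_embedding (w : PauliLevel (m + 1) 1) :
    ∃ φ : PauliSpace m →ₗ[ZMod 2] PauliSpace (m + 1),
      (∀ u v, sympProd (φ u) (φ v) = sympProd u v) ∧ LinearMap.range φ ≤ sympPerp w.1 ∧
        Disjoint (LinearMap.range φ) w.1 := by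
  obtain ⟨b, hb, hw⟩ := finrank_eq_one_iff'.1 w.2.2
  have hb' : (b : PauliSpace (m + 1)) ≠ 0 := fun h => hb (Subtype.ext h)
  have hspan : w.1 = span (ZMod 2) {(b : PauliSpace (m + 1))} := by
    refine le_antisymm (fun v hv => ?_) ((span_singleton_le_iff_mem _ _).2 b.2)
    obtain ⟨c, hc⟩ := hw ⟨v, hv⟩
    exact mem_span_singleton.2 ⟨c, congrArg Subtype.val hc⟩
  -- The image of `pauliCons` is orthogonal to `e` and meets its span trivially; an isometry carries
  -- `e` to the generator of `w`.
  set e : PauliSpace (m + 1) := (Pi.single 0 1, 0) with he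
  have he0 : e ≠ 0 := fun h => by simpa [he] using congrFun (congrArg Prod.fst h) 0
  obtain ⟨g, hg, hge⟩ := exists_isometry_map_eq he0 hb'
  have hinj := isometry_injective hg
  refine ⟨g ∘ₗ pauliCons m, fun u v => ?_, ?_, ?_⟩
  · rw [LinearMap.comp_apply, LinearMap.comp_apply, hg, sympProd_pauliCons]
  · rintro _ ⟨u, rfl⟩
    rw [hspan, mem_sympPerp_span, ← hge, LinearMap.comp_apply, hg]
    simp [he, pauliCons, sympProd]
  · rw [Submodule.disjoint_def]
    rintro _ ⟨u, rfl⟩ hu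
    rw [hspan] at hu
    obtain ⟨c, hc⟩ := mem_span_singleton.1 hu
    rw [← hge, ← map_smul, LinearMap.comp_apply] at hc
    have hc' := congrFun (congrArg Prod.fst (hinj hc)) 0
    have hc0 : c = 0 := by simpa [he, pauliCons] using hc'
    rw [LinearMap.comp_apply, ← hc, hc0, zero_smul, map_zero]

section

variable {φ : PauliSpace m →ₗ[ZMod 2] PauliSpace (m + 1)}

theorem finrank_map_sup (hφ : ∀ u v, sympProd (φ u) (φ v) = sympProd u v)
    (hd : Disjoint (LinearMap.range φ) w.1) (y : Submodule (ZMod 2) (PauliSpace m)) :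
    finrank (ZMod 2) ↥(y.map φ ⊔ w.1) = finrank (ZMod 2) y + 1 := by
  have h₁ := Submodule.finrank_sup_add_finrank_inf_eq (y.map φ) w.1
  have h₂ : Disjoint (y.map φ) w.1 := hd.mono_left LinearMap.map_le_range
  rw [h₂.eq_bot, finrank_bot, w.2.2,
    ← (equivMapOfInjective φ (isometry_injective hφ) y).finrank_eq] at h₁
  exact h₁

theorem comap_map_sup (hφ : ∀ u v, sympProd (φ u) (φ v) = sympProd u v)
    (hd : Disjoint (LinearMap.range φ) w.1) (y : Submodule (ZMod 2) (PauliSpace m)) :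
    (y.map φ ⊔ w.1).comap φ = y := by
  refine le_antisymm (fun u hu => ?_) (map_le_iff_le_comap.1 le_sup_left)
  obtain ⟨_, ⟨v, hv, rfl⟩, t, ht, h⟩ := mem_sup.1 (mem_comap.1 hu)
  have h' : φ (u - v) = t := by rw [map_sub, ← h, add_sub_cancel_left]
  have h0 := Submodule.disjoint_def.1 hd t ⟨_, h'⟩ ht
  rw [h0, ← map_zero φ] at h'
  rwa [sub_eq_zero.1 (isometry_injective hφ h')]

/-- By dimension, `range φ + w = w^⊥`, which contains `x`; the modular law then applies. -/
theorem map_comap_sup (hφ : ∀ u v, sympProd (φ u) (φ v) = sympProd u v)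
    (hr : LinearMap.range φ ≤ sympPerp w.1) (hd : Disjoint (LinearMap.range φ) w.1)
    {x : Submodule (ZMod 2) (PauliSpace (m + 1))} (hx : IsIsotropic x) (hwx : w.1 ≤ x) :
    (x.comap φ).map φ ⊔ w.1 = x := by
  have h₁ : LinearMap.range φ ⊔ w.1 = sympPerp w.1 := by
    refine eq_of_le_of_finrank_eq (sup_le hr (isIsotropic_iff_le_sympPerp.1 w.2.1)) ?_
    have h₂ := finrank_sympPerp_add w.1
    have h₃ := finrank_map_sup hφ hd ⊤
    rw [Submodule.map_top, finrank_top, finrank_pauliSpace] at h₃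
    rw [w.2.2] at h₂
    lia
  have h₂ : x ≤ sympPerp w.1 := (isIsotropic_iff_le_sympPerp.1 hx).trans (sympPerp_anti hwx)
  rw [map_comap_eq, sup_comm, ← sup_inf_assoc_of_le _ hwx, sup_comm w.1, h₁, inf_eq_right.2 h₂]

end

theorem nonempty_halfGraph_iso (w : PauliLevel (m + 1) 1) :
    Nonempty (halfGraph w ≃g dualPolarGraph ((m + 1) / 2) m) := by
  obtain ⟨φ, hφ, hr, hd⟩ := exists_embedding w
  have hup : ∀ y : PauliLevel m m, IsIsotropic (y.1.map φ ⊔ w.1) := fun y => by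
    refine IsIsotropic.sup ?_ w.2.1 ?_
    · rintro _ ⟨u, hu, rfl⟩ _ ⟨v, hv, rfl⟩
      rw [hφ]
      exact y.2.1 u hu v hv
    · exact (sympPerp_sympPerp w.1).ge.trans (sympPerp_anti (LinearMap.map_le_range.trans hr))
  have hdim : ∀ x : Submodule (ZMod 2) (PauliSpace (m + 1)), IsIsotropic x → w.1 ≤ x →
      finrank (ZMod 2) x = finrank (ZMod 2) (x.comap φ) + 1 := fun x hx hwx => by
    rw [← finrank_map_sup hφ hd, map_comap_sup hφ hr hd hx hwx]
  let f : PauliAbove w ≃ PauliLevel m m :=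
    { toFun := fun x => ⟨x.1.1.comap φ, fun u hu v hv => by
        rw [← hφ]; exact x.1.2.1 _ hu _ hv, by
        have := hdim x.1.1 x.1.2.1 x.2
        rw [x.1.2.2] at this
        lia⟩
      invFun := fun y => ⟨⟨y.1.map φ ⊔ w.1, hup y, by
        rw [finrank_map_sup hφ hd, y.2.2]⟩, le_sup_right⟩
      left_inv := fun x => Subtype.ext (Subtype.ext (map_comap_sup hφ hr hd x.1.2.1 x.2))
      right_inv := fun y => Subtype.ext (comap_map_sup hφ hd y.1) }
  -- Preimages commute with intersections, and `x ∩ y` contains `w`, so its dimension and the rank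
  -- both drop by one.
  have hdist : ∀ x y, pauliDist (f x) (f y) = pauliDist x.1 y.1 := fun x y => by
    have h := hdim (x.1.1 ⊓ y.1.1) (x.1.2.1.mono inf_le_left) (le_inf x.2 y.2)
    rw [comap_inf] at h
    unfold pauliDist
    change m - finrank (ZMod 2) ↥(x.1.1.comap φ ⊓ y.1.1.comap φ) = _
    lia
  refine ⟨⟨f, fun {x y} => ?_⟩⟩
  change f x ≠ f y ∧ pauliDist (f x) (f y) = (m + 1) / 2 ↔
    x ≠ y ∧ pauliDist x.1 y.1 = (m + 1) / 2
  rw [hdist, f.injective.ne_iff]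

end Embedding

theorem mainTheorem9 (n : ℕ) (hn : Even n) (w : PauliLevel n 1) :
    (∀ x : Submodule (ZMod 2) (PauliSpace n),
      (∃ v : PauliAbove w, v.1.1 = x) ↔ (Maximal IsIsotropic x ∧ w.1 ≤ x)) ∧
    (∀ x y : PauliAbove w, (halfGraph w).Adj x y ↔
      Module.finrank (ZMod 2) ↥(x.1.1 ⊓ y.1.1) = n / 2) ∧
    Nonempty (halfGraph w ≃g dualPolarGraph (n / 2) (n - 1)) ∧
    spectralRatio (halfGraph w) = (2 : ℝ) ^ (-(n : ℝ) / 2) ∧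
    Real.logb 2 (spectralRatio (halfGraph w)) = -(n : ℝ) / 2 := by
  have hpos : 1 ≤ n := w.2.2.ge.trans (finrank_le_of_isIsotropic w.2.1)
  obtain ⟨m, rfl⟩ : ∃ m, n = m + 1 := ⟨n - 1, by lia⟩
  obtain ⟨i, hi⟩ := hn
  obtain ⟨e⟩ := nonempty_halfGraph_iso w
  have hratio : spectralRatio (halfGraph w) = (2 : ℝ) ^ (-((m + 1 : ℕ) : ℝ) / 2) := by
    -- Since `n` is even and positive, `1 ≤ n / 2 ≤ n - 1`.
    rw [spectralRatio_eq_of_iso e, spectralRatio_dualPolarGraph (by lia) (by lia), hi,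
      show (i + i) / 2 = i by lia, ← Real.rpow_natCast, ← Real.rpow_neg two_pos.le]
    congr 1
    push_cast
    ring
  refine ⟨fun x => ?_, fun x y => ?_, ⟨e⟩, hratio, ?_⟩
  · rw [maximal_isIsotropic_iff]
    constructor
    · rintro ⟨v, rfl⟩
      exact ⟨v.1.2, v.2⟩
    · rintro ⟨h, hw⟩
      exact ⟨⟨⟨x, h⟩, hw⟩, rfl⟩
  · have h := pauliDist_add x.1 y.1
    change x ≠ y ∧ pauliDist x.1 y.1 = (m + 1) / 2 ↔ _
    constructor
    · rintro ⟨-, h'⟩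
      lia
    · intro h'
      refine ⟨?_, by lia⟩
      rintro rfl
      have := pauliDist_eq_zero.2 (rfl : x.1 = x.1)
      lia
  · rw [hratio, Real.logb_rpow two_pos (by norm_num)]
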